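/- **Proposition 9 (PE direct products).** Let $(M_1,g_1)$ be a Lorentzian manifold (signature $(-,+,\dots,+)$) of dimension $n_1\ge 1$ and $(M_2,g_2)$ a Riemannian manifold of dimension $n_2\ge 1$, both smooth and without boundary, and let $(M,g)=(M_1\times M_2,\,g_1\oplus g_2)$ be their direct product, of dimension $n=n_1+n_2$. For a metric $g_{ab}$ in dimension $n\ge 3$ with Riemann tensor $R_{abcd}$, Ricci tensor $R_{bd}=R^a{}_{bad}$ and Ricci scalar $R$, the Weyl tensor is $$C_{abcd}=R_{abcd}-\frac{1}{n-2}\left(g_{ac}R_{bd}-g_{ad}R_{bc}-g_{bc}R_{ad}+g_{bd}R_{ac}\right)+\frac{R}{(n-1)(n-2)}\left(g_{ac}g_{bd}-g_{ad}g_{bc}\right),$$ and $C_{abcd}=0$ by convention in dimension at most $2$. For a unit timelike vector $u$ (that is, $g_{ab}u^au^b=-1$) put $h_{ab}=g_{ab}+u_au_b$. The manifold is called *purely electric (PE) with respect to $u$* at a point if there the magnetic part of the Weyl tensor $$(C_-)^{ab}{}_{cd}=2h^{ae}h^{bf}C_{efk[c}u_{d]}u^k+2u_ku^{[a}C^{b]kef}h_{ce}h_{df}$$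 vanishes, where square brackets denote antisymmetrization with weight $\tfrac12$; it is PE with respect to $u$ on a set of points if this holds at each of them. A nonzero vector $u$ is an eigenvector of the Ricci tensor at a point if $R^a{}_bu^b=\mu u^a$ there for some real number $\mu$; on a set of points, $\mu$ may depend on the point. Let $S\subseteq M$ be a set of points (for instance a single point, an open region, or all of $M$), and for each $p=(p_1,p_2)\in S$ let $u_p\in T_{p_1}M_1$ be a unit timelike vector of $g_1$, also regarded as the vector $(u_p,0)\in T_pM$ (so that $u$ lives in $M_1$). Then $M$ is PE with respect to $u$ at all points $p\in S$ if and only if, for all $p=(p_1,p_2)\in S$, the vector $u_p$ is an eigenvector of the Ricci tensor of $M_1$ at $p_1$ and $M_1$ is PE with respect to $u_p$ at $p_1$. In that case, at every $p\in S$, $u$ is also an eigenvector of the Ricci tensor $R_{ab}$ of $M$, i.e. $R_{ab}u^aw^b=0$ for every $w\in T_pM$ orthogonal to $u$. -/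

import Mathlib

set_option maxSynthPendingDepth 3

open scoped Manifold ContDiff Topology
open Bundle

namespace Lorentz

section PullForm

variable {V W : Type*} [AddCommGroup V] [Module ℝ V] [TopologicalSpace V]
  [AddCommGroup W] [Module ℝ W] [TopologicalSpace W]

/-- The pullback `(v, w) ↦ b (L v) (L w)` of a bilinear form `b` under a linear map `L`. -/
noncomputable def pullForm [IsTopologicalAddGroup V] [ContinuousConstSMul ℝ V]
    [IsTopologicalAddGroup W] [ContinuousConstSMul ℝ W]
    (b : W →L[ℝ] W →L[ℝ] ℝ) (L : V →L[ℝ] W) : V →L[ℝ] V →L[ℝ] ℝ :=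
  (L.precomp ℝ) ∘L b ∘L L

@[simp] theorem pullForm_apply [IsTopologicalAddGroup V] [ContinuousConstSMul ℝ V]
    [IsTopologicalAddGroup W] [ContinuousConstSMul ℝ W]
    (b : W →L[ℝ] W →L[ℝ] ℝ) (L : V →L[ℝ] W) (v w : V) :
    pullForm b L v w = b (L v) (L w) := rfl

end PullForm

section SmoothForms

variable {E H : Type*} [NormedAddCommGroup E] [NormedSpace ℝ E]
    [TopologicalSpace H] {I : ModelWithCorners ℝ E H}
    {M : Type*} [TopologicalSpace M] [ChartedSpace H M] [IsManifold I ∞ M]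
    {E' H' : Type*} [NormedAddCommGroup E'] [NormedSpace ℝ E']
    [TopologicalSpace H'] {J : ModelWithCorners ℝ E' H'}
    {N : Type*} [TopologicalSpace N] [ChartedSpace H' N] [IsManifold J ∞ N]

/-- Smoothness of a field of bilinear forms, in coordinates. -/
theorem contMDiffAt_form_iff (b : ∀ p : M, TangentSpace I p →L[ℝ] TangentSpace I p →L[ℝ] ℝ)
    (p₀ : M) :
    ContMDiffAt I (I.prod 𝓘(ℝ, E →L[ℝ] E →L[ℝ] ℝ)) ∞
      (fun p ↦ TotalSpace.mk' (E →L[ℝ] E →L[ℝ] ℝ)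
        (E := fun p ↦ TangentSpace I p →L[ℝ] TangentSpace I p →L[ℝ] ℝ) p (b p)) p₀ ↔
    ContMDiffAt I 𝓘(ℝ, E →L[ℝ] E →L[ℝ] ℝ) ∞
      (fun p ↦ pullForm (b p) ((trivializationAt E (TangentSpace I) p₀).symmL ℝ p)) p₀ := by
  rw [contMDiffAt_section]
  apply Filter.EventuallyEq.contMDiffAt_iff
  have h : (chartAt H p₀).source ∈ 𝓝 p₀ := chart_source_mem_nhds H p₀
  filter_upwards [h] with p hp
  ext v w
  rw [hom_trivializationAt_apply]
  rw [inCoordinates_apply_eq₂ (by simpa using hp) (by simpa using hp) (by simp)]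
  have hp' : p ∈ (trivializationAt E (TangentSpace I) p₀).baseSet := by simpa using hp
  simp only [pullForm_apply, Trivialization.symmL_apply _ hp']
  simp

/-- The pullback of a smooth field of bilinear forms by a smooth map is smooth. -/
theorem contMDiff_pullback (b : ∀ p : N, TangentSpace J p →L[ℝ] TangentSpace J p →L[ℝ] ℝ)
    (hb : ContMDiff J (J.prod 𝓘(ℝ, E' →L[ℝ] E' →L[ℝ] ℝ)) ∞
      (fun p ↦ TotalSpace.mk' (E' →L[ℝ] E' →L[ℝ] ℝ)
        (E := fun p ↦ TangentSpace J p →L[ℝ] TangentSpace J p →L[ℝ] ℝ) p (b p)))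
    {f : M → N} (hf : ContMDiff I J ∞ f) :
    ContMDiff I (I.prod 𝓘(ℝ, E →L[ℝ] E →L[ℝ] ℝ)) ∞
      (fun p ↦ TotalSpace.mk' (E →L[ℝ] E →L[ℝ] ℝ)
        (E := fun p ↦ TangentSpace I p →L[ℝ] TangentSpace I p →L[ℝ] ℝ) p
        (pullForm (b (f p)) (mfderiv I J f p))) := by
  intro p₀
  rw [contMDiffAt_form_iff]
  have h1 := ((contMDiffAt_form_iff b (f p₀)).1 (hb (f p₀))).comp p₀ (hf p₀)
  have h2 := (hf p₀).mfderiv_const (m := ∞) (n := ∞) (by simp)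
  have h3 : ContMDiffAt I 𝓘(ℝ, E →L[ℝ] E →L[ℝ] ℝ) ∞ (fun p ↦
      pullForm (pullForm (b (f p)) ((trivializationAt E' (TangentSpace J) (f p₀)).symmL ℝ (f p)))
        (inTangentCoordinates I J id f (mfderiv I J f) p₀ p)) p₀ := by
    have h4 : ContMDiffAt I 𝓘(ℝ, (E' →L[ℝ] ℝ) →L[ℝ] (E →L[ℝ] ℝ)) ∞ (fun p ↦
        (inTangentCoordinates I J id f (mfderiv I J f) p₀ p).precomp ℝ) p₀ :=
      ContMDiffAt.clm_precomp h2
    exact h4.clm_comp (h1.clm_comp h2)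
  refine h3.congr_of_eventuallyEq ?_
  have hn : (chartAt H p₀).source ∈ 𝓝 p₀ := chart_source_mem_nhds H p₀
  have hn' : f ⁻¹' (chartAt H' (f p₀)).source ∈ 𝓝 p₀ :=
    hf.continuous.continuousAt.preimage_mem_nhds (chart_source_mem_nhds H' (f p₀))
  filter_upwards [hn, hn'] with p hp hp'
  have hq : f p ∈ (trivializationAt E' (TangentSpace J) (f p₀)).baseSet := by simpa using hp'
  have key (z : E) : (trivializationAt E' (TangentSpace J) (f p₀)).symmL ℝ (f p)
      (inTangentCoordinates I J id f (mfderiv I J f) p₀ p z) =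
      mfderiv I J f p ((trivializationAt E (TangentSpace I) p₀).symmL ℝ p z) :=
    (trivializationAt E' (TangentSpace J) (f p₀)).symmL_continuousLinearMapAt hq _
  ext v w
  simp only [pullForm_apply, key]

end SmoothForms

/-- A smooth pseudo-Riemannian metric on a manifold: a smooth field of symmetric nondegenerate
bilinear forms on the tangent spaces. -/
structure PseudoRiemannianMetric {E H : Type*} [NormedAddCommGroup E] [NormedSpace ℝ E]
    [TopologicalSpace H] (I : ModelWithCorners ℝ E H)
    (M : Type*) [TopologicalSpace M] [ChartedSpace H M] [IsManifold I ∞ M] where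
  val (p : M) : TangentSpace I p →L[ℝ] TangentSpace I p →L[ℝ] ℝ
  symm (p : M) (v w : TangentSpace I p) : val p v w = val p w v
  nondegenerate (p : M) (v : TangentSpace I p) (hv : ∀ w, val p v w = 0) : v = 0
  contMDiff : ContMDiff I (I.prod 𝓘(ℝ, E →L[ℝ] E →L[ℝ] ℝ)) ∞
    (fun p ↦ TotalSpace.mk' (E →L[ℝ] E →L[ℝ] ℝ)
      (E := fun p ↦ TangentSpace I p →L[ℝ] TangentSpace I p →L[ℝ] ℝ) p (val p))

/-! ### Curvature in a coordinate domain

Here `G : E → (E →L[ℝ] E →L[ℝ] ℝ)` gives the components of a metric in a chart with values in the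
vector space `E`. -/

section Coordinates

variable {E : Type*} [NormedAddCommGroup E] [NormedSpace ℝ E]

/-- The Christoffel symbols of the first kind,
`Γ(v, w; z) = (∂_v G(w, z) + ∂_w G(v, z) - ∂_z G(v, w)) / 2`. -/
noncomputable def christoffelFirst (G : E → E →L[ℝ] E →L[ℝ] ℝ) (y : E) :
    E →L[ℝ] E →L[ℝ] E →L[ℝ] ℝ :=
  (1 / 2 : ℝ) • (fderiv ℝ G y + (fderiv ℝ G y).flip -
    (ContinuousLinearMap.flipₗᵢ ℝ E E ℝ).toContinuousLinearEquiv.toContinuousLinearMap ∘L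
      (fderiv ℝ G y).flip)

theorem christoffelFirst_apply (G : E → E →L[ℝ] E →L[ℝ] ℝ) (y v w z : E) :
    christoffelFirst G y v w z =
      (1 / 2) * (fderiv ℝ G y v w z + fderiv ℝ G y w v z - fderiv ℝ G y z v w) := rfl

/-- The Christoffel symbols `Γ(v, w)` of the second kind: the index `z` of the symbols of the first
kind is raised with the inverse of the metric `G y : E → E*`. -/
noncomputable def christoffel (G : E → E →L[ℝ] E →L[ℝ] ℝ) (y : E) : E →L[ℝ] E →L[ℝ] E :=
  (ContinuousLinearMap.compL ℝ E (E →L[ℝ] ℝ) E (G y).inverse) ∘L christoffelFirst G y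

theorem christoffel_apply (G : E → E →L[ℝ] E →L[ℝ] ℝ) (y v w : E) :
    christoffel G y v w = (G y).inverse (christoffelFirst G y v w) := rfl

/-- The Riemann curvature `R(v, w) z = ∇_v ∇_w z - ∇_w ∇_v z` on constant vector fields. -/
noncomputable def coordCurvature (G : E → E →L[ℝ] E →L[ℝ] ℝ) (y v w z : E) : E :=
  fderiv ℝ (christoffel G) y v w z - fderiv ℝ (christoffel G) y w v z
    + christoffel G y v (christoffel G y w z) - christoffel G y w (christoffel G y v z)

variable (G : E → E →L[ℝ] E →L[ℝ] ℝ) (y v v' w w' z z' : E) (r : ℝ)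

theorem coordCurvature_add₁ : coordCurvature G y (v + v') w z =
    coordCurvature G y v w z + coordCurvature G y v' w z := by
  simp only [coordCurvature, map_add, add_apply]
  abel

theorem coordCurvature_smul₁ : coordCurvature G y (r • v) w z = r • coordCurvature G y v w z := by
  simp only [coordCurvature, map_smul, smul_apply]
  module

theorem coordCurvature_add₂ : coordCurvature G y v (w + w') z =
    coordCurvature G y v w z + coordCurvature G y v w' z := by
  simp only [coordCurvature, map_add, add_apply]
  abel

theorem coordCurvature_smul₂ : coordCurvature G y v (r • w) z = r • coordCurvature G y v w z := by
  simp only [coordCurvature, map_smul, smul_apply]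
  module

theorem coordCurvature_add₃ : coordCurvature G y v w (z + z') =
    coordCurvature G y v w z + coordCurvature G y v w z' := by
  simp only [coordCurvature, map_add]
  abel

theorem coordCurvature_smul₃ : coordCurvature G y v w (r • z) = r • coordCurvature G y v w z := by
  simp only [coordCurvature, map_smul]
  module

end Coordinates

namespace PseudoRiemannianMetric

section Curvature

variable {E H : Type*} [NormedAddCommGroup E] [NormedSpace ℝ E]
  [TopologicalSpace H] {I : ModelWithCorners ℝ E H}
  {M : Type*} [TopologicalSpace M] [ChartedSpace H M] [IsManifold I ∞ M]

/-- The metric is Lorentzian, with signature `(-, +, …, +)`. -/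
def IsLorentzian (g : PseudoRiemannianMetric I M) : Prop :=
  ∀ p : M, ∃ t : TangentSpace I p, g.val p t t < 0 ∧
    ∀ w : TangentSpace I p, g.val p t w = 0 → w ≠ 0 → 0 < g.val p w w

/-- The metric is Riemannian, i.e. positive definite. -/
def IsRiemannian (g : PseudoRiemannianMetric I M) : Prop :=
  ∀ (p : M) (w : TangentSpace I p), w ≠ 0 → 0 < g.val p w w

/-- The components of the metric in the preferred chart around `p`, as a function on the model
vector space: the pullback of the metric under the inverse of the chart. -/
noncomputable def coordMetric (g : PseudoRiemannianMetric I M) (p : M) (y : E) :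
    E →L[ℝ] E →L[ℝ] ℝ :=
  pullForm (g.val ((extChartAt I p).symm y)) (mfderiv 𝓘(ℝ, E) I (extChartAt I p).symm y)

/-- The Riemann curvature `R(X, Y) Z` at `p`, computed in the preferred chart around `p` (through
which `TangentSpace I p` is identified with `E`). -/
noncomputable def curvature (g : PseudoRiemannianMetric I M) (p : M) (X Y Z : TangentSpace I p) :
    TangentSpace I p :=
  coordCurvature (E := E) (g.coordMetric p) (extChartAt I p p) X Y Z

/-- The Riemann tensor `R_{abcd}`, with `R(X, Y) Z = R^a_{bcd} Z^b X^c Y^d`. -/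
noncomputable def riemann (g : PseudoRiemannianMetric I M) (p : M) (a b c d : TangentSpace I p) :
    ℝ :=
  g.val p a (g.curvature p c d b)

/-- The endomorphism `X ↦ R(X, Y) Z` of the tangent space. -/
noncomputable def curvatureEnd (g : PseudoRiemannianMetric I M) (p : M)
    (Y Z : TangentSpace I p) : TangentSpace I p →ₗ[ℝ] TangentSpace I p where
  toFun X := g.curvature p X Y Z
  map_add' X X' := coordCurvature_add₁ (E := E) _ _ X X' Y Z
  map_smul' r X := coordCurvature_smul₁ (E := E) _ _ X Y Z r

/-- The Ricci tensor `R_{bd} = R^a_{bad}`, i.e. `Ric(Z, Y) = tr (X ↦ R(X, Y) Z)`. -/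
noncomputable def ricci (g : PseudoRiemannianMetric I M) (p : M) :
    LinearMap.BilinForm ℝ (TangentSpace I p) :=
  LinearMap.mk₂ ℝ (fun Z Y ↦ LinearMap.trace ℝ (TangentSpace I p) (g.curvatureEnd p Y Z))
    (fun Z Z' Y ↦ by
      rw [← map_add]; congr 1; ext X; exact coordCurvature_add₃ (E := E) _ _ X Y Z Z')
    (fun r Z Y ↦ by
      rw [← map_smul]; congr 1; ext X; exact coordCurvature_smul₃ (E := E) _ _ X Y Z r)
    (fun Z Y Y' ↦ by
      rw [← map_add]; congr 1; ext X; exact coordCurvature_add₂ (E := E) _ _ X Y Y' Z)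
    (fun r Z Y ↦ by
      rw [← map_smul]; congr 1; ext X; exact coordCurvature_smul₂ (E := E) _ _ X Y Z r)

/-- The metric at a point, as a bilinear form. -/
noncomputable def form (g : PseudoRiemannianMetric I M) (p : M) :
    LinearMap.BilinForm ℝ (TangentSpace I p) :=
  ContinuousLinearMap.coeLM ℝ ∘ₗ (g.val p).toLinearMap

theorem form_nondegenerate (g : PseudoRiemannianMetric I M) (p : M) : (g.form p).Nondegenerate :=
  ⟨fun v hv ↦ g.nondegenerate p v hv,
    fun v hv ↦ g.nondegenerate p v fun w ↦ (g.symm p v w).trans (hv w)⟩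

variable [FiniteDimensional ℝ E]

instance (p : M) : FiniteDimensional ℝ (TangentSpace I p) :=
  inferInstanceAs (FiniteDimensional ℝ E)

/-- The Ricci operator `R^a_b`, defined by `g(R v, w) = Ric(v, w)`. -/
noncomputable def ricciOp (g : PseudoRiemannianMetric I M) (p : M) :
    Module.End ℝ (TangentSpace I p) :=
  ((g.form p).toDual (g.form_nondegenerate p)).symm.toLinearMap ∘ₗ g.ricci p

theorem val_ricciOp (g : PseudoRiemannianMetric I M) (p : M) (v w : TangentSpace I p) :
    g.val p (g.ricciOp p v) w = g.ricci p v w :=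
  LinearMap.BilinForm.apply_toDual_symm_apply (hB := g.form_nondegenerate p) (g.ricci p v) w

/-- `u` is an eigenvector of the Ricci tensor at `p`: `u ≠ 0` and `R^a_b u^b = μ u^a` for some
real number `μ`. -/
def IsRicciEigenvector (g : PseudoRiemannianMetric I M) (p : M) (u : TangentSpace I p) : Prop :=
  ∃ μ : ℝ, Module.End.HasEigenvector (g.ricciOp p) μ u

/-- The scalar curvature `R = R^a_a`. -/
noncomputable def scalarCurvature (g : PseudoRiemannianMetric I M) (p : M) : ℝ :=
  LinearMap.trace ℝ (TangentSpace I p) (g.ricciOp p)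

/-- The Weyl tensor `C_{abcd}` in dimension `n = dim M`:
`C_{abcd} = R_{abcd} - (g_{ac} R_{bd} - g_{ad} R_{bc} - g_{bc} R_{ad} + g_{bd} R_{ac}) / (n - 2)
  + R (g_{ac} g_{bd} - g_{ad} g_{bc}) / ((n - 1) (n - 2))`.
In dimension at most two, where this expression does not make sense, the Weyl tensor is zero. -/
noncomputable def weyl (g : PseudoRiemannianMetric I M) (p : M) (a b c d : TangentSpace I p) : ℝ :=
  if Module.finrank ℝ E ≤ 2 then 0 else
    g.riemann p a b c d
      - (g.val p a c * g.ricci p b d - g.val p a d * g.ricci p b c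
          - g.val p b c * g.ricci p a d + g.val p b d * g.ricci p a c)
        / ((Module.finrank ℝ E : ℝ) - 2)
      + g.scalarCurvature p * (g.val p a c * g.val p b d - g.val p a d * g.val p b c)
        / (((Module.finrank ℝ E : ℝ) - 1) * ((Module.finrank ℝ E : ℝ) - 2))

/-- `u` is a unit timelike vector at `p`. -/
def IsUnitTimelike (g : PseudoRiemannianMetric I M) (p : M) (u : TangentSpace I p) : Prop :=
  g.val p u u = -1

/-- The projector `h^a_b = δ^a_b + u^a u_b`, for a unit timelike vector `u` the orthogonal
projection onto the orthogonal complement of `u`. -/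
noncomputable def orthProj (g : PseudoRiemannianMetric I M) (p : M) (u v : TangentSpace I p) :
    TangentSpace I p :=
  v + g.val p u v • u

/-- The magnetic part of the Weyl tensor with respect to `u`, with all indices lowered:
`(C₋)_{abcd} = 2 h_a^e h_b^f C_{efk[c} u_{d]} u^k + 2 u_k u_{[a} C_{b]}^{kef} h_{ce} h_{df}`,
where square brackets denote antisymmetrization with weight `1 / 2`. -/
noncomputable def weylMagnetic (g : PseudoRiemannianMetric I M) (p : M)
    (u a b c d : TangentSpace I p) : ℝ :=
  (g.weyl p (g.orthProj p u a) (g.orthProj p u b) u c * g.val p u d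
      - g.weyl p (g.orthProj p u a) (g.orthProj p u b) u d * g.val p u c)
    + (g.val p u a * g.weyl p b u (g.orthProj p u c) (g.orthProj p u d)
      - g.val p u b * g.weyl p a u (g.orthProj p u c) (g.orthProj p u d))

/-- The Weyl tensor is purely electric (PE) at `p` with respect to `u`: its magnetic part
vanishes. -/
def IsPurelyElectricAt (g : PseudoRiemannianMetric I M) (p : M) (u : TangentSpace I p) : Prop :=
  ∀ a b c d : TangentSpace I p, g.weylMagnetic p u a b c d = 0

end Curvature

section Product

variable {E₁ H₁ : Type*} [NormedAddCommGroup E₁] [NormedSpace ℝ E₁]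
  [TopologicalSpace H₁] {I₁ : ModelWithCorners ℝ E₁ H₁}
  {M₁ : Type*} [TopologicalSpace M₁] [ChartedSpace H₁ M₁] [IsManifold I₁ ∞ M₁]
  {E₂ H₂ : Type*} [NormedAddCommGroup E₂] [NormedSpace ℝ E₂]
  [TopologicalSpace H₂] {I₂ : ModelWithCorners ℝ E₂ H₂}
  {M₂ : Type*} [TopologicalSpace M₂] [ChartedSpace H₂ M₂] [IsManifold I₂ ∞ M₂]

/-- The direct product metric `g₁ ⊕ g₂ = π₁^* g₁ + π₂^* g₂` on `M₁ × M₂`. -/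
noncomputable def prod (g₁ : PseudoRiemannianMetric I₁ M₁) (g₂ : PseudoRiemannianMetric I₂ M₂) :
    PseudoRiemannianMetric (I₁.prod I₂) (M₁ × M₂) where
  val p := pullForm (g₁.val p.1) (mfderiv (I₁.prod I₂) I₁ Prod.fst p) +
    pullForm (g₂.val p.2) (mfderiv (I₁.prod I₂) I₂ Prod.snd p)
  symm p v w := congr_arg₂ (· + ·) (g₁.symm p.1 _ _) (g₂.symm p.2 _ _)
  nondegenerate p v hv := by
    have hv' (w : TangentSpace (I₁.prod I₂) p) : g₁.val p.1 v.1 w.1 + g₂.val p.2 v.2 w.2 = 0 := by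
      have h := hv w
      rw [mfderiv_fst, mfderiv_snd] at h
      exact h
    refine Prod.ext (g₁.nondegenerate p.1 _ fun w ↦ ?_) (g₂.nondegenerate p.2 _ fun w ↦ ?_)
    · have h := hv' ((w, 0) : TangentSpace I₁ p.1 × TangentSpace I₂ p.2)
      rwa [map_zero, add_zero] at h
    · have h := hv' ((0, w) : TangentSpace I₁ p.1 × TangentSpace I₂ p.2)
      rwa [map_zero, zero_add] at h
  contMDiff p₀ := by
    rw [contMDiffAt_form_iff]
    have h₁ := (contMDiffAt_form_iff _ p₀).1
      (contMDiff_pullback g₁.val g₁.contMDiff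
        (contMDiff_fst : ContMDiff (I₁.prod I₂) I₁ ∞ (Prod.fst : M₁ × M₂ → M₁)) p₀)
    have h₂ := (contMDiffAt_form_iff _ p₀).1
      (contMDiff_pullback g₂.val g₂.contMDiff
        (contMDiff_snd : ContMDiff (I₁.prod I₂) I₂ ∞ (Prod.snd : M₁ × M₂ → M₂)) p₀)
    exact h₁.add h₂

theorem prod_val_apply (g₁ : PseudoRiemannianMetric I₁ M₁) (g₂ : PseudoRiemannianMetric I₂ M₂)
    (p : M₁ × M₂) (v w : TangentSpace (I₁.prod I₂) p) :
    (g₁.prod g₂).val p v w = g₁.val p.1 v.1 w.1 + g₂.val p.2 v.2 w.2 := by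
  have h : (g₁.prod g₂).val p v w =
      g₁.val p.1 (mfderiv (I₁.prod I₂) I₁ Prod.fst p v) (mfderiv (I₁.prod I₂) I₁ Prod.fst p w) +
      g₂.val p.2 (mfderiv (I₁.prod I₂) I₂ Prod.snd p v) (mfderiv (I₁.prod I₂) I₂ Prod.snd p w) :=
    rfl
  rw [h, mfderiv_fst, mfderiv_snd]
  rfl

end Product

end PseudoRiemannianMetric

/-- The vector `(u, 0)` tangent to `M₁ × M₂` at `p` that is given by a vector `u` tangent to the
first factor: the image of `u` under the derivative of the inclusion `q ↦ (q, p.2)` of `M₁`. The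
vectors of this form are those that live in `M₁`. -/
noncomputable def liftFst {E₁ H₁ : Type*} [NormedAddCommGroup E₁] [NormedSpace ℝ E₁]
    [TopologicalSpace H₁] (I₁ : ModelWithCorners ℝ E₁ H₁)
    {M₁ : Type*} [TopologicalSpace M₁] [ChartedSpace H₁ M₁]
    {E₂ H₂ : Type*} [NormedAddCommGroup E₂] [NormedSpace ℝ E₂]
    [TopologicalSpace H₂] (I₂ : ModelWithCorners ℝ E₂ H₂)
    {M₂ : Type*} [TopologicalSpace M₂] [ChartedSpace H₂ M₂]
    (p : M₁ × M₂) (u : TangentSpace I₁ p.1) : TangentSpace (I₁.prod I₂) p :=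
  mfderiv I₁ (I₁.prod I₂) (fun q : M₁ ↦ (q, p.2)) p.1 u

end Lorentz

/-!
The Riemann and Ricci tensors of a direct product are block diagonal. This holds in the preferred
charts: the product metric splits there (`coordMetric_prod`), hence so do its Christoffel symbols
and its curvature (`coordCurvature_prod`), and the trace of a block diagonal endomorphism is the sum
of the traces (`riemann_prod`, `ricci_prod`).

By the pair symmetry of the Weyl tensor, the magnetic part vanishes if and only if `C_{abuc} = 0` for
all `a`, `b`, `c` orthogonal to `u` (`isPurelyElectricAt_iff`). For `u` tangent to the first factor
this component of the Weyl tensor of the product is (`weyl_prod_liftFst`)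
`R₁(a₁, b₁, u, c₁) + (g(a, c) Ric₁(u, b₁) - g(b, c) Ric₁(u, a₁)) / (n - 2)`.
If it vanishes for all `a`, `b`, `c`, then taking `a = c` nonzero and tangent to the second factor
and `b` tangent to the first gives `Ric₁(u, b) = 0` for `b` orthogonal to `u`, i.e. `u` is a Ricci
eigenvector. For a Ricci eigenvector `u`, the components `C_{abuc}` of the Weyl tensors of `M` and of
`M₁` both reduce to `R₁(a₁, b₁, u, c₁)`, so they vanish together. In dimension at most two, where
the Weyl tensor of `M₁` is zero by convention, `R₁(a₁, b₁, u, c₁)` vanishes because `a₁` and `b₁` lie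
on a line (`riemann_eq_zero_of_finrank_le_two`).

The symmetries of the Riemann tensor that this uses are proved in coordinates
(`metric_coordCurvature_pair_symm`), and the symmetry of the Ricci tensor follows from them
(`ricci_symm`).
-/

namespace Lorentz

/-! ### Curvature of a metric given in coordinates -/

section CoordinateCurvature

variable {E : Type*} [NormedAddCommGroup E] [NormedSpace ℝ E]

theorem eventually_isInvertible [CompleteSpace E] {G : E → E →L[ℝ] E →L[ℝ] ℝ} {y : E}
    (hc : ContinuousAt G y) (hi : (G y).IsInvertible) : ∀ᶠ x in 𝓝 y, (G x).IsInvertible :=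
  hc.eventually (ContinuousLinearEquiv.isOpen.mem_nhds hi)

theorem contDiffAt_christoffelFirst {G : E → E →L[ℝ] E →L[ℝ] ℝ} {y : E}
    (hc : ContDiffAt ℝ ∞ G y) : ContDiffAt ℝ ∞ (christoffelFirst G) y := by
  have h0 : ContDiffAt ℝ ∞ (fderiv ℝ G) y := hc.fderiv_right (by simp)
  have h1 : ContDiffAt ℝ ∞ (fun x ↦ (fderiv ℝ G x).flip) y :=
    (ContinuousLinearMap.flipₗᵢ ℝ E E (E →L[ℝ] ℝ)).contDiff.comp_contDiffAt y h0
  exact ((h0.add h1).sub (contDiffAt_const.clm_comp h1)).const_smul (1 / 2 : ℝ)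

theorem contDiffAt_christoffel [CompleteSpace E] {G : E → E →L[ℝ] E →L[ℝ] ℝ} {y : E}
    (hc : ContDiffAt ℝ ∞ G y) (hi : (G y).IsInvertible) : ContDiffAt ℝ ∞ (christoffel G) y := by
  have h1 : ContDiffAt ℝ ∞ (fun x ↦ (G x).inverse) y := hi.contDiffAt_map_inverse.comp y hc
  exact (((ContinuousLinearMap.compL ℝ E (E →L[ℝ] ℝ) E).contDiff.comp_contDiffAt y h1).clm_comp
    (contDiffAt_christoffelFirst hc))

/-- The Christoffel symbols of the second kind, characterized by lowering the index. -/
theorem metric_christoffel {G : E → E →L[ℝ] E →L[ℝ] ℝ} {y : E} (hi : (G y).IsInvertible)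
    (v w z : E) : G y (christoffel G y v w) z = christoffelFirst G y v w z := by
  rw [christoffel_apply, hi.self_apply_inverse]

theorem fderiv_metric_symm {G : E → E →L[ℝ] E →L[ℝ] ℝ} {y : E} (hd : DifferentiableAt ℝ G y)
    (hs : ∀ x v w, G x v w = G x w v) (x v w : E) :
    fderiv ℝ G y x v w = fderiv ℝ G y x w v := by
  have h (a b : E) : HasFDerivAt (fun x ↦ G x a b)
      ((ContinuousLinearMap.apply ℝ ℝ b ∘L ContinuousLinearMap.apply ℝ _ a) ∘L fderiv ℝ G y) y :=
    (ContinuousLinearMap.apply ℝ ℝ b ∘L ContinuousLinearMap.apply ℝ _ a).hasFDerivAt.comp y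
      hd.hasFDerivAt
  have e := (h v w).unique ((h w v).congr_of_eventuallyEq (.of_forall fun x ↦ hs x v w))
  exact congr($e x)

theorem christoffel_symm {G : E → E →L[ℝ] E →L[ℝ] ℝ} {y : E} (hd : DifferentiableAt ℝ G y)
    (hs : ∀ x v w, G x v w = G x w v) (v w : E) :
    christoffel G y v w = christoffel G y w v := by
  rw [christoffel_apply, christoffel_apply]
  congr 1
  ext z
  rw [christoffelFirst_apply, christoffelFirst_apply, fderiv_metric_symm hd hs z v w]
  ring

/-- Metric compatibility `∂_x G(a, z) = Γ(x, a; z) + Γ(x, z; a)`. -/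
theorem fderiv_metric {G : E → E →L[ℝ] E →L[ℝ] ℝ} {y : E} (hd : DifferentiableAt ℝ G y)
    (hi : (G y).IsInvertible) (hs : ∀ x v w, G x v w = G x w v) (x a z : E) :
    fderiv ℝ G y x a z = G y (christoffel G y x a) z + G y (christoffel G y x z) a := by
  rw [metric_christoffel hi, metric_christoffel hi, christoffelFirst_apply, christoffelFirst_apply,
    fderiv_metric_symm hd hs x z a, fderiv_metric_symm hd hs z x a, fderiv_metric_symm hd hs a x z]
  ring

/-- The derivative of the Christoffel symbols of the second kind, with the index lowered: obtained
by differentiating `G(Γ(v, w), z) = Γ(v, w; z)`. -/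
theorem metric_fderiv_christoffel [CompleteSpace E] {G : E → E →L[ℝ] E →L[ℝ] ℝ} {y : E}
    (hc : ContDiffAt ℝ ∞ G y) (hi : (G y).IsInvertible) (x v w z : E) :
    G y (fderiv ℝ (christoffel G) y x v w) z =
      (1 / 2) * (fderiv ℝ (fderiv ℝ G) y x v w z + fderiv ℝ (fderiv ℝ G) y x w v z
        - fderiv ℝ (fderiv ℝ G) y x z v w) - fderiv ℝ G y x (christoffel G y v w) z := by
  have hd : HasFDerivAt G (fderiv ℝ G y) y := (hc.differentiableAt (by simp)).hasFDerivAt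
  have hd' : HasFDerivAt (fderiv ℝ G) (fderiv ℝ (fderiv ℝ G) y) y :=
    ((hc.fderiv_right (m := ∞) (by simp)).differentiableAt (by simp)).hasFDerivAt
  have hΓ : HasFDerivAt (christoffel G) (fderiv ℝ (christoffel G) y) y :=
    ((contDiffAt_christoffel hc hi).differentiableAt (by simp)).hasFDerivAt
  have h1 := (hd.clm_apply ((hΓ.clm_apply (hasFDerivAt_const v y)).clm_apply
    (hasFDerivAt_const w y))).clm_apply (hasFDerivAt_const z y)
  have h2 (v w z : E) := ((hd'.clm_apply (hasFDerivAt_const v y)).clm_apply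
    (hasFDerivAt_const w y)).clm_apply (hasFDerivAt_const z y)
  have h3 := (((h2 v w z).add (h2 w v z)).sub (h2 z v w)).const_mul (1 / 2 : ℝ)
  have h4 := h1.congr_of_eventuallyEq (f₁ := fun x ↦ (1 / 2) * (fderiv ℝ G x v w z
      + fderiv ℝ G x w v z - fderiv ℝ G x z v w)) (by
    filter_upwards [eventually_isInvertible hc.continuousAt hi] with x hx
    rw [metric_christoffel hx, christoffelFirst_apply])
  have e := congr($(h4.unique h3) x)
  simp at e
  simp
  linarith

/-- The Riemann tensor with all indices lowered, in terms of the second derivatives of the metric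
and of the Christoffel symbols. The first derivatives of the metric are eliminated with
`fderiv_metric`, so that the right-hand side shows the symmetries of the tensor. -/
theorem metric_coordCurvature [CompleteSpace E] {G : E → E →L[ℝ] E →L[ℝ] ℝ} {y : E}
    (hc : ContDiffAt ℝ ∞ G y) (hi : (G y).IsInvertible) (hs : ∀ x v w, G x v w = G x w v)
    (v w z t : E) :
    G y (coordCurvature G y v w z) t =
      (1 / 2) * (fderiv ℝ (fderiv ℝ G) y v z w t - fderiv ℝ (fderiv ℝ G) y v t w z
        - fderiv ℝ (fderiv ℝ G) y w z v t + fderiv ℝ (fderiv ℝ G) y w t v z)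
      - G y (christoffel G y v t) (christoffel G y w z)
      + G y (christoffel G y w t) (christoffel G y v z) := by
  have hd : DifferentiableAt ℝ G y := hc.differentiableAt (by simp)
  have hsymm : fderiv ℝ (fderiv ℝ G) y v w z t = fderiv ℝ (fderiv ℝ G) y w v z t := by
    rw [(hc.isSymmSndFDerivAt (by simpa using WithTop.coe_le_coe.2 (le_top : (2 : ℕ∞) ≤ ⊤))).eq v w]
  simp only [coordCurvature, map_add, map_sub, add_apply, sub_apply,
    metric_fderiv_christoffel hc hi, fderiv_metric hd hi hs, hsymm]
  ring

/-- Pair symmetry of the Riemann tensor, from the symmetry of second derivatives and of `G`. -/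
theorem metric_coordCurvature_pair_symm [CompleteSpace E] {G : E → E →L[ℝ] E →L[ℝ] ℝ} {y : E}
    (hc : ContDiffAt ℝ ∞ G y) (hi : (G y).IsInvertible) (hs : ∀ x v w, G x v w = G x w v)
    (v w z t : E) :
    G y (coordCurvature G y v w z) t = G y (coordCurvature G y t z w) v := by
  have hd : DifferentiableAt ℝ G y := hc.differentiableAt (by simp)
  have hd' : HasFDerivAt (fderiv ℝ G) (fderiv ℝ (fderiv ℝ G) y) y :=
    ((hc.fderiv_right (m := ∞) (by simp)).differentiableAt (by simp)).hasFDerivAt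
  have hsym (a b c d : E) :
      fderiv ℝ (fderiv ℝ G) y a b c d = fderiv ℝ (fderiv ℝ G) y b a c d := by
    rw [(hc.isSymmSndFDerivAt (by simpa using WithTop.coe_le_coe.2 (le_top : (2 : ℕ∞) ≤ ⊤))).eq a b]
  have hsym' (a b c d : E) :
      fderiv ℝ (fderiv ℝ G) y a b c d = fderiv ℝ (fderiv ℝ G) y a b d c := by
    have h (c d : E) := ((hd'.clm_apply (hasFDerivAt_const b y)).clm_apply
      (hasFDerivAt_const c y)).clm_apply (hasFDerivAt_const d y)
    have hev : ∀ᶠ x in 𝓝 y, fderiv ℝ G x b c d = fderiv ℝ G x b d c := by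
      filter_upwards [(hc.of_le (m := 1) (by simp)).eventually (by simp)] with x hx
      exact fderiv_metric_symm (hx.differentiableAt (by simp)) hs b c d
    have e := congr($(((h d c).congr_of_eventuallyEq hev).unique (h c d)) a)
    simpa using e.symm
  rw [metric_coordCurvature hc hi hs, metric_coordCurvature hc hi hs,
    hsym v z w t, hsym' z v w t, hsym' v t w z, hsym v t z w, hsym' w z v t, hsym w z t v,
    hsym w t v z, hsym' t w v z, christoffel_symm hd hs t v, christoffel_symm hd hs z w,
    christoffel_symm hd hs z v, christoffel_symm hd hs t w,
    hs y (christoffel G y v z)]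
  ring

end CoordinateCurvature

namespace PseudoRiemannianMetric

/-! ### The metric in the preferred chart -/

section CoordMetric

variable {E H : Type*} [NormedAddCommGroup E] [NormedSpace ℝ E]
  [TopologicalSpace H] {I : ModelWithCorners ℝ E H}
  {M : Type*} [TopologicalSpace M] [ChartedSpace H M] [IsManifold I ∞ M]

theorem coordMetric_symm (g : PseudoRiemannianMetric I M) (p : M) (y v w : E) :
    g.coordMetric p y v w = g.coordMetric p y w v :=
  g.symm _ _ _

theorem riemann_antisymm_right (g : PseudoRiemannianMetric I M) (p : M)
    (a b c d : TangentSpace I p) : g.riemann p a b c d = -g.riemann p a b d c := by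
  have h : g.curvature p c d b = -g.curvature p d c b := by
    simp only [curvature, coordCurvature]
    abel
  rw [riemann, riemann, h, map_neg]

/-- Congruence for `g.val` in the base point, with the tangent vectors read in the model space so
that the statement does not transport them along `p = q`. -/
theorem val_congr (g : PseudoRiemannianMetric I M) {p q : M} (h : p = q) {v w v' w' : E}
    (hv : v = v') (hw : w = w') :
    (g.val p : E →L[ℝ] E →L[ℝ] ℝ) v w = (g.val q : E →L[ℝ] E →L[ℝ] ℝ) v' w' := by
  rw [h, hv, hw]

variable [I.Boundaryless]

/-- At `p` itself the derivative of the preferred chart is the identity. -/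
theorem coordMetric_self (g : PseudoRiemannianMetric I M) (p : M) (v w : E) :
    g.coordMetric p (extChartAt I p p) v w = g.val p v w := by
  have : IsManifold I 1 M := .of_le (n := ∞) (by simp)
  have h := mfderivWithin_range_extChartAt_symm (I := I) (x := p)
  rw [I.range_eq_univ, mfderivWithin_univ] at h
  exact g.val_congr (extChartAt_to_inv p) congr($h v) congr($h w)

/-- Near `p`, the derivative of the inverse chart is the inverse of the trivialization of the
tangent bundle, in which the metric is smooth. -/
theorem contDiffAt_coordMetric (g : PseudoRiemannianMetric I M) (p : M) :
    ContDiffAt ℝ ∞ (g.coordMetric p) (extChartAt I p p) := by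
  have : IsManifold I 1 M := .of_le (n := ∞) (by simp)
  have h1 := (contMDiffAt_form_iff g.val p).1 (g.contMDiff p)
  have h2 : ContMDiffAt 𝓘(ℝ, E) I ∞ (extChartAt I p).symm (extChartAt I p p) :=
    (contMDiffOn_extChartAt_symm p).contMDiffAt (extChartAt_target_mem_nhds p)
  rw [← extChartAt_to_inv (I := I) p] at h1
  have h3 := h1.comp (extChartAt I p p) h2
  rw [extChartAt_to_inv (I := I) p] at h3
  refine (contMDiffAt_iff_contDiffAt.1 h3).congr_of_eventuallyEq ?_
  filter_upwards [extChartAt_target_mem_nhds (I := I) p] with y hy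
  have hs : (extChartAt I p).symm y ∈ (chartAt H p).source := by
    simpa using (extChartAt I p).map_target hy
  have h4 := TangentBundle.symmL_trivializationAt (I := I) hs
  rw [I.range_eq_univ, mfderivWithin_univ, (extChartAt I p).right_inv hy] at h4
  simp only [Function.comp, coordMetric, h4]

theorem isInvertible_coordMetric [FiniteDimensional ℝ E] (g : PseudoRiemannianMetric I M) (p : M) :
    (g.coordMetric p (extChartAt I p p)).IsInvertible := by
  have hinj : Function.Injective
      ((LinearMap.toContinuousLinearMap (𝕜 := ℝ) (E := E) (F' := ℝ)).symm.toLinearMap ∘ₗ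
        (g.coordMetric p (extChartAt I p p)).toLinearMap) := by
    rw [injective_iff_map_eq_zero]
    intro v hv
    refine g.nondegenerate p v fun w ↦ ?_
    exact (g.coordMetric_self p v w).symm.trans congr($hv w)
  let e := (LinearEquiv.ofInjectiveOfFinrankEq _ hinj Subspace.dual_finrank_eq.symm).trans
    LinearMap.toContinuousLinearMap
  exact ⟨e.toContinuousLinearEquiv, by ext v w; rfl⟩

theorem riemann_pair_symm [FiniteDimensional ℝ E] (g : PseudoRiemannianMetric I M) (p : M)
    (a b c d : TangentSpace I p) : g.riemann p a b c d = g.riemann p c d a b := by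
  have := FiniteDimensional.complete ℝ E
  have h := metric_coordCurvature_pair_symm (g.contDiffAt_coordMetric p)
    (g.isInvertible_coordMetric p) (g.coordMetric_symm p) c d b a
  rw [riemann, riemann, g.symm, g.symm p c]
  exact (g.coordMetric_self p _ a).symm.trans (h.trans (g.coordMetric_self p _ c))

theorem riemann_antisymm_left [FiniteDimensional ℝ E] (g : PseudoRiemannianMetric I M) (p : M)
    (a b c d : TangentSpace I p) : g.riemann p a b c d = -g.riemann p b a c d := by
  rw [riemann_pair_symm, riemann_antisymm_right, riemann_pair_symm]

/-- The Ricci tensor is symmetric: by pair symmetry, `X ↦ R(X, Y) Z` and `X ↦ R(X, Z) Y` are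
adjoint with respect to the metric. -/
theorem ricci_symm [FiniteDimensional ℝ E] (g : PseudoRiemannianMetric I M) (p : M)
    (Y Z : TangentSpace I p) : g.ricci p Y Z = g.ricci p Z Y := by
  let e := (g.form p).toDual (g.form_nondegenerate p)
  have h : e.conj (g.curvatureEnd p Y Z) = Module.Dual.transpose (g.curvatureEnd p Z Y) := by
    refine LinearMap.ext fun f ↦ ?_
    obtain ⟨X, rfl⟩ := e.surjective f
    refine LinearMap.ext fun W ↦ ?_
    have h := g.riemann_pair_symm p W Z X Y
    rw [riemann, riemann, g.symm] at h
    rw [LinearEquiv.conj_apply_apply, e.symm_apply_apply]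
    exact h
  change LinearMap.trace ℝ _ (g.curvatureEnd p Z Y) = LinearMap.trace ℝ _ (g.curvatureEnd p Y Z)
  rw [← LinearMap.trace_transpose', ← h, LinearMap.trace_conj']

end CoordMetric

end PseudoRiemannianMetric

/-! ### Curvature of a direct product -/

section CoordinateProduct

variable {E₁ E₂ : Type*} [NormedAddCommGroup E₁] [NormedSpace ℝ E₁]
  [NormedAddCommGroup E₂] [NormedSpace ℝ E₂]
  {G : E₁ × E₂ → E₁ × E₂ →L[ℝ] E₁ × E₂ →L[ℝ] ℝ} {G₁ : E₁ → E₁ →L[ℝ] E₁ →L[ℝ] ℝ}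
  {G₂ : E₂ → E₂ →L[ℝ] E₂ →L[ℝ] ℝ} {x : E₁ × E₂}

theorem fderiv_metric_prod
    (hG : ∀ᶠ y in 𝓝 x, ∀ v w, G y v w = G₁ y.1 v.1 w.1 + G₂ y.2 v.2 w.2)
    (hd : DifferentiableAt ℝ G x) (hd₁ : DifferentiableAt ℝ G₁ x.1)
    (hd₂ : DifferentiableAt ℝ G₂ x.2) (a v w : E₁ × E₂) :
    fderiv ℝ G x a v w = fderiv ℝ G₁ x.1 a.1 v.1 w.1 + fderiv ℝ G₂ x.2 a.2 v.2 w.2 := by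
  have h := (hd.hasFDerivAt.clm_apply (hasFDerivAt_const v x)).clm_apply (hasFDerivAt_const w x)
  have h₁ := ((hd₁.hasFDerivAt.comp x hasFDerivAt_fst).clm_apply
    (hasFDerivAt_const v.1 x)).clm_apply (hasFDerivAt_const w.1 x)
  have h₂ := ((hd₂.hasFDerivAt.comp x hasFDerivAt_snd).clm_apply
    (hasFDerivAt_const v.2 x)).clm_apply (hasFDerivAt_const w.2 x)
  have e := congr($(h.unique ((h₁.add h₂).congr_of_eventuallyEq (hG.mono fun y hy ↦ hy v w))) a)
  simpa using e

theorem christoffel_prod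
    (hG : ∀ᶠ y in 𝓝 x, ∀ v w, G y v w = G₁ y.1 v.1 w.1 + G₂ y.2 v.2 w.2)
    (hd : DifferentiableAt ℝ G x) (hd₁ : DifferentiableAt ℝ G₁ x.1)
    (hd₂ : DifferentiableAt ℝ G₂ x.2) (hi : (G x).IsInvertible) (hi₁ : (G₁ x.1).IsInvertible)
    (hi₂ : (G₂ x.2).IsInvertible) (v w : E₁ × E₂) :
    christoffel G x v w = (christoffel G₁ x.1 v.1 w.1, christoffel G₂ x.2 v.2 w.2) := by
  rw [christoffel_apply, hi.inverse_apply_eq]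
  refine ContinuousLinearMap.ext fun z ↦ ?_
  rw [hG.self_of_nhds, metric_christoffel hi₁, metric_christoffel hi₂, christoffelFirst_apply,
    christoffelFirst_apply, christoffelFirst_apply]
  simp only [fderiv_metric_prod hG hd hd₁ hd₂]
  ring

/-- The curvature of a metric that splits near `x` splits. The hypothesis is only local, because
off the target of a chart the components of a product metric are junk values, which need not
split. -/
theorem coordCurvature_prod [CompleteSpace E₁] [CompleteSpace E₂]
    (hG : ∀ᶠ y in 𝓝 x, ∀ v w, G y v w = G₁ y.1 v.1 w.1 + G₂ y.2 v.2 w.2)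
    (hc : ContDiffAt ℝ ∞ G x) (hc₁ : ContDiffAt ℝ ∞ G₁ x.1)
    (hc₂ : ContDiffAt ℝ ∞ G₂ x.2) (hi : (G x).IsInvertible) (hi₁ : (G₁ x.1).IsInvertible)
    (hi₂ : (G₂ x.2).IsInvertible) (v w z : E₁ × E₂) :
    coordCurvature G x v w z =
      (coordCurvature G₁ x.1 v.1 w.1 z.1, coordCurvature G₂ x.2 v.2 w.2 z.2) := by
  have hev : ∀ᶠ y in 𝓝 x, ∀ v w,
      christoffel G y v w = (christoffel G₁ y.1 v.1 w.1, christoffel G₂ y.2 v.2 w.2) := by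
    have hf : ContinuousAt Prod.fst x := continuousAt_fst
    have hs : ContinuousAt Prod.snd x := continuousAt_snd
    filter_upwards [hG.eventually_nhds,
      (hc.of_le (m := 1) (by simp)).eventually (by simp),
      hf.eventually ((hc₁.of_le (m := 1) (by simp)).eventually (by simp)),
      hs.eventually ((hc₂.of_le (m := 1) (by simp)).eventually (by simp)),
      eventually_isInvertible hc.continuousAt hi,
      hf.eventually (eventually_isInvertible hc₁.continuousAt hi₁),
      hs.eventually (eventually_isInvertible hc₂.continuousAt hi₂)] with y h0 h1 h2 h3 h4 h5 h6
    exact christoffel_prod h0 (h1.differentiableAt (by simp)) (h2.differentiableAt (by simp))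
      (h3.differentiableAt (by simp)) h4 h5 h6
  have hΓ := ((contDiffAt_christoffel hc hi).differentiableAt (by simp)).hasFDerivAt
  have hΓ₁ := ((contDiffAt_christoffel hc₁ hi₁).differentiableAt (by simp)).hasFDerivAt
  have hΓ₂ := ((contDiffAt_christoffel hc₂ hi₂).differentiableAt (by simp)).hasFDerivAt
  have key (a v w : E₁ × E₂) : fderiv ℝ (christoffel G) x a v w =
      (fderiv ℝ (christoffel G₁) x.1 a.1 v.1 w.1, fderiv ℝ (christoffel G₂) x.2 a.2 v.2 w.2) := by
    have h := (hΓ.clm_apply (hasFDerivAt_const v x)).clm_apply (hasFDerivAt_const w x)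
    have h₁ := ((hΓ₁.comp x hasFDerivAt_fst).clm_apply
      (hasFDerivAt_const v.1 x)).clm_apply (hasFDerivAt_const w.1 x)
    have h₂ := ((hΓ₂.comp x hasFDerivAt_snd).clm_apply
      (hasFDerivAt_const v.2 x)).clm_apply (hasFDerivAt_const w.2 x)
    have e := congr($(h.unique ((h₁.prodMk h₂).congr_of_eventuallyEq
      (hev.mono fun y hy ↦ hy v w))) a)
    simpa using e
  simp only [coordCurvature, key, hev.self_of_nhds]
  rfl

end CoordinateProduct

theorem mdifferentiableAt_extChartAt_symm {E H : Type*} [NormedAddCommGroup E] [NormedSpace ℝ E]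
    [TopologicalSpace H] {I : ModelWithCorners ℝ E H} [I.Boundaryless]
    {M : Type*} [TopologicalSpace M] [ChartedSpace H M] [IsManifold I ∞ M] {p : M} {y : E}
    (hy : y ∈ (extChartAt I p).target) :
    MDifferentiableAt 𝓘(ℝ, E) I (extChartAt I p).symm y :=
  ((contMDiffOn_extChartAt_symm (n := ∞) p).contMDiffAt
    ((isOpen_extChartAt_target p).mem_nhds hy)).mdifferentiableAt (by simp)

namespace PseudoRiemannianMetric

section ProductCurvature

variable {E₁ H₁ : Type*} [NormedAddCommGroup E₁] [NormedSpace ℝ E₁]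
  [TopologicalSpace H₁] {I₁ : ModelWithCorners ℝ E₁ H₁} [I₁.Boundaryless]
  {M₁ : Type*} [TopologicalSpace M₁] [ChartedSpace H₁ M₁] [IsManifold I₁ ∞ M₁]
  {E₂ H₂ : Type*} [NormedAddCommGroup E₂] [NormedSpace ℝ E₂]
  [TopologicalSpace H₂] {I₂ : ModelWithCorners ℝ E₂ H₂} [I₂.Boundaryless]
  {M₂ : Type*} [TopologicalSpace M₂] [ChartedSpace H₂ M₂] [IsManifold I₂ ∞ M₂]
  (g₁ : PseudoRiemannianMetric I₁ M₁) (g₂ : PseudoRiemannianMetric I₂ M₂) (p : M₁ × M₂)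

theorem fst_mfderiv_extChartAt_prod_symm {p : M₁ × M₂} {y : E₁ × E₂}
    (hy : y ∈ (extChartAt (I₁.prod I₂) p).target) (v : E₁ × E₂) :
    (mfderiv 𝓘(ℝ, E₁ × E₂) (I₁.prod I₂) (extChartAt (I₁.prod I₂) p).symm y v : E₁ × E₂).1 =
      mfderiv 𝓘(ℝ, E₁) I₁ (extChartAt I₁ p.1).symm y.1 v.1 := by
  have hy₁ : y.1 ∈ (extChartAt I₁ p.1).target := by
    rw [extChartAt_prod] at hy
    exact hy.1
  have e : mfderiv (I₁.prod I₂) I₁ Prod.fst ((extChartAt (I₁.prod I₂) p).symm y) ∘L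
      mfderiv 𝓘(ℝ, E₁ × E₂) (I₁.prod I₂) (extChartAt (I₁.prod I₂) p).symm y =
      mfderiv 𝓘(ℝ, E₁) I₁ (extChartAt I₁ p.1).symm y.1 ∘L
        mfderiv 𝓘(ℝ, E₁ × E₂) 𝓘(ℝ, E₁) Prod.fst y :=
    (mfderiv_comp y mdifferentiableAt_fst (mdifferentiableAt_extChartAt_symm hy)).symm.trans
      (mfderiv_comp y (mdifferentiableAt_extChartAt_symm hy₁)
        differentiableAt_fst.mdifferentiableAt)
  rw [mfderiv_eq_fderiv, fderiv_fst, mfderiv_fst] at e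
  exact congr($e v)

theorem snd_mfderiv_extChartAt_prod_symm {p : M₁ × M₂} {y : E₁ × E₂}
    (hy : y ∈ (extChartAt (I₁.prod I₂) p).target) (v : E₁ × E₂) :
    (mfderiv 𝓘(ℝ, E₁ × E₂) (I₁.prod I₂) (extChartAt (I₁.prod I₂) p).symm y v : E₁ × E₂).2 =
      mfderiv 𝓘(ℝ, E₂) I₂ (extChartAt I₂ p.2).symm y.2 v.2 := by
  have hy₂ : y.2 ∈ (extChartAt I₂ p.2).target := by
    rw [extChartAt_prod] at hy
    exact hy.2
  have e : mfderiv (I₁.prod I₂) I₂ Prod.snd ((extChartAt (I₁.prod I₂) p).symm y) ∘L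
      mfderiv 𝓘(ℝ, E₁ × E₂) (I₁.prod I₂) (extChartAt (I₁.prod I₂) p).symm y =
      mfderiv 𝓘(ℝ, E₂) I₂ (extChartAt I₂ p.2).symm y.2 ∘L
        mfderiv 𝓘(ℝ, E₁ × E₂) 𝓘(ℝ, E₂) Prod.snd y :=
    (mfderiv_comp y mdifferentiableAt_snd (mdifferentiableAt_extChartAt_symm hy)).symm.trans
      (mfderiv_comp y (mdifferentiableAt_extChartAt_symm hy₂)
        differentiableAt_snd.mdifferentiableAt)
  rw [mfderiv_eq_fderiv, fderiv_snd, mfderiv_snd] at e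
  exact congr($e v)

theorem coordMetric_prod : ∀ᶠ y in 𝓝 (extChartAt (I₁.prod I₂) p p), ∀ v w : E₁ × E₂,
    (g₁.prod g₂).coordMetric p y v w =
      g₁.coordMetric p.1 y.1 v.1 w.1 + g₂.coordMetric p.2 y.2 v.2 w.2 := by
  filter_upwards [extChartAt_target_mem_nhds (I := I₁.prod I₂) p] with y hy v w
  have h := prod_val_apply g₁ g₂ ((extChartAt (I₁.prod I₂) p).symm y)
    (mfderiv 𝓘(ℝ, E₁ × E₂) (I₁.prod I₂) (extChartAt (I₁.prod I₂) p).symm y v)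
    (mfderiv 𝓘(ℝ, E₁ × E₂) (I₁.prod I₂) (extChartAt (I₁.prod I₂) p).symm y w)
  have h₁ := val_congr g₁ (p := ((extChartAt (I₁.prod I₂) p).symm y).1)
    (q := (extChartAt I₁ p.1).symm y.1) rfl (fst_mfderiv_extChartAt_prod_symm hy v)
    (fst_mfderiv_extChartAt_prod_symm hy w)
  have h₂ := val_congr g₂ (p := ((extChartAt (I₁.prod I₂) p).symm y).2)
    (q := (extChartAt I₂ p.2).symm y.2) rfl (snd_mfderiv_extChartAt_prod_symm hy v)
    (snd_mfderiv_extChartAt_prod_symm hy w)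
  exact h.trans (congr_arg₂ (· + ·) h₁ h₂)

variable [FiniteDimensional ℝ E₁] [FiniteDimensional ℝ E₂]

theorem curvature_prod (X Y Z : TangentSpace (I₁.prod I₂) p) :
    (g₁.prod g₂).curvature p X Y Z =
      ((g₁.curvature p.1 X.1 Y.1 Z.1, g₂.curvature p.2 X.2 Y.2 Z.2) :
        TangentSpace I₁ p.1 × TangentSpace I₂ p.2) := by
  have := FiniteDimensional.complete ℝ E₁
  have := FiniteDimensional.complete ℝ E₂
  exact coordCurvature_prod (coordMetric_prod g₁ g₂ p) (contDiffAt_coordMetric _ p)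
    (contDiffAt_coordMetric g₁ p.1) (contDiffAt_coordMetric g₂ p.2) (isInvertible_coordMetric _ p)
    (isInvertible_coordMetric g₁ p.1) (isInvertible_coordMetric g₂ p.2) X Y Z

theorem riemann_prod (a b c d : TangentSpace (I₁.prod I₂) p) :
    (g₁.prod g₂).riemann p a b c d =
      g₁.riemann p.1 a.1 b.1 c.1 d.1 + g₂.riemann p.2 a.2 b.2 c.2 d.2 := by
  rw [riemann, prod_val_apply, curvature_prod]
  rfl

theorem ricci_prod (Y Z : TangentSpace (I₁.prod I₂) p) :
    (g₁.prod g₂).ricci p Y Z = g₁.ricci p.1 Y.1 Z.1 + g₂.ricci p.2 Y.2 Z.2 := by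
  have h : (g₁.prod g₂).curvatureEnd p Z Y =
      (g₁.curvatureEnd p.1 Z.1 Y.1).prodMap (g₂.curvatureEnd p.2 Z.2 Y.2) :=
    LinearMap.ext fun X ↦ curvature_prod g₁ g₂ p X Z Y
  change LinearMap.trace ℝ _ ((g₁.prod g₂).curvatureEnd p Z Y) = _
  rw [h]
  exact LinearMap.trace_prodMap' _ _

end ProductCurvature

/-! ### Purely electric Weyl tensors and Ricci eigenvectors at a point -/

section Pointwise

variable {E H : Type*} [NormedAddCommGroup E] [NormedSpace ℝ E]
  [TopologicalSpace H] {I : ModelWithCorners ℝ E H}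
  {M : Type*} [TopologicalSpace M] [ChartedSpace H M] [IsManifold I ∞ M]
  (g : PseudoRiemannianMetric I M) (p : M)

theorem riemann_add_smul_left (a a' b c d : TangentSpace I p) (r s : ℝ) :
    g.riemann p (r • a + s • a') b c d = r * g.riemann p a b c d + s * g.riemann p a' b c d := by
  simp [riemann]

theorem riemann_add_smul_right (a b c d d' : TangentSpace I p) (r : ℝ) :
    g.riemann p a b c (d + r • d') = g.riemann p a b c d + r * g.riemann p a b c d' := by
  have h : g.curvature p c (d + r • d') b = g.curvature p c d b + r • g.curvature p c d' b :=
    (coordCurvature_add₂ (E := E) _ _ _ _ _ _).trans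
      congr($(rfl) + $(coordCurvature_smul₂ (E := E) _ _ _ _ _ r))
  rw [riemann, h]
  simp [riemann]

theorem riemann_zero_left (b c d : TangentSpace I p) : g.riemann p 0 b c d = 0 := by
  simp [riemann]

theorem riemann_zero_third (a b d : TangentSpace I p) : g.riemann p a b 0 d = 0 := by
  have h := coordCurvature_smul₁ (E := E) (g.coordMetric p) (extChartAt I p p) 0 d b 0
  rw [zero_smul, zero_smul] at h
  exact congr(g.val p a $h).trans (map_zero _)

variable {g p} in
theorem IsUnitTimelike.ne_zero {u : TangentSpace I p} (hu : g.IsUnitTimelike p u) : u ≠ 0 := by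
  rintro rfl
  simp [IsUnitTimelike] at hu

variable {g p} in
theorem IsUnitTimelike.val_orthProj {u : TangentSpace I p} (hu : g.IsUnitTimelike p u)
    (v : TangentSpace I p) : g.val p u (g.orthProj p u v) = 0 := by
  rw [IsUnitTimelike] at hu
  simp [orthProj, hu]

theorem orthProj_of_orthogonal {u v : TangentSpace I p} (hv : g.val p u v = 0) :
    g.orthProj p u v = v := by
  simp [orthProj, hv]

variable [FiniteDimensional ℝ E]

theorem weyl_antisymm_right (a b c d : TangentSpace I p) :
    g.weyl p a b c d = -g.weyl p a b d c := by
  simp only [weyl]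
  split_ifs
  · simp
  · rw [riemann_antisymm_right]
    ring

theorem weyl_self_right (a b c : TangentSpace I p) : g.weyl p a b c c = 0 := by
  linarith [g.weyl_antisymm_right p a b c c]

theorem weyl_add_smul_right (a b c d d' : TangentSpace I p) (r : ℝ) :
    g.weyl p a b c (d + r • d') = g.weyl p a b c d + r * g.weyl p a b c d' := by
  simp only [weyl]
  split_ifs
  · simp
  · simp only [riemann_add_smul_right, map_add, map_smul, smul_eq_mul]
    ring

/-- Only the component of the last slot orthogonal to `u` contributes to `C_{abuc}`. -/
theorem weyl_orthProj_right (u a b c : TangentSpace I p) :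
    g.weyl p a b u (g.orthProj p u c) = g.weyl p a b u c := by
  rw [orthProj, weyl_add_smul_right, weyl_self_right, mul_zero, add_zero]

/-- A unit timelike `u` is an eigenvector of the Ricci tensor as soon as the mixed components
`R_{ab} u^a w^b`, with `w` orthogonal to `u`, vanish. -/
theorem isRicciEigenvector_iff {u : TangentSpace I p} (hu : g.IsUnitTimelike p u) :
    g.IsRicciEigenvector p u ↔ ∀ w, g.val p u w = 0 → g.ricci p u w = 0 := by
  constructor
  · rintro ⟨μ, hμ⟩ w hw
    rw [← val_ricciOp, hμ.apply_eq_smul]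
    simp [hw]
  · intro h
    -- The eigenvalue is forced by `g(u, u) = -1`.
    refine ⟨-g.ricci p u u, Module.End.hasEigenvector_iff.2
      ⟨Module.End.mem_eigenspace_iff.2 (sub_eq_zero.1 (g.nondegenerate p _ fun w ↦ ?_)),
        hu.ne_zero⟩⟩
    have hw := h _ (hu.val_orthProj w)
    simp only [orthProj, map_add, map_smul, smul_eq_mul] at hw
    simp only [map_sub, map_smul, sub_apply, smul_apply, val_ricciOp, smul_eq_mul]
    linarith

theorem isPurelyElectricAt_of_finrank_le_two (hn : Module.finrank ℝ E ≤ 2)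
    (u : TangentSpace I p) : g.IsPurelyElectricAt p u := by
  intro a b c d
  simp [weylMagnetic, weyl, hn]

theorem eq_zero_of_orthogonal_of_finrank_le_one (hn : Module.finrank ℝ E ≤ 1)
    {u : TangentSpace I p} (hu : g.IsUnitTimelike p u) {w : TangentSpace I p}
    (hw : g.val p u w = 0) : w = 0 := by
  have huu : g.val p u u = -1 := hu
  obtain ⟨v, hv⟩ := finrank_le_one_iff.1 (show Module.finrank ℝ (TangentSpace I p) ≤ 1 from hn)
  obtain ⟨r, hr⟩ := hv u
  obtain ⟨s, hs⟩ := hv w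
  have hr0 : r ≠ 0 := by
    rintro rfl
    exact hu.ne_zero (by rw [← hr, zero_smul])
  have hws : w = (s / r) • u := by
    rw [← hr, ← hs, smul_smul, div_mul_cancel₀ _ hr0]
  rw [hws, map_smul, huu, smul_eq_mul] at hw
  rw [hws, show s / r = 0 by linarith, zero_smul]

variable [I.Boundaryless]

theorem weyl_pair_symm (a b c d : TangentSpace I p) :
    g.weyl p a b c d = g.weyl p c d a b := by
  simp only [weyl]
  split_ifs
  · rfl
  · rw [riemann_pair_symm, g.ricci_symm p b d, g.ricci_symm p b c, g.ricci_symm p a d,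
      g.ricci_symm p a c, g.symm p a c, g.symm p a d, g.symm p b c, g.symm p b d]
    ring

/-- The Weyl tensor is purely electric with respect to `u` if and only if `C_{abuc} = 0` for all
`a`, `b`, `c` orthogonal to `u`. -/
theorem isPurelyElectricAt_iff {u : TangentSpace I p} (hu : g.IsUnitTimelike p u) :
    g.IsPurelyElectricAt p u ↔ ∀ a b c, g.val p u a = 0 → g.val p u b = 0 → g.val p u c = 0 →
      g.weyl p a b u c = 0 := by
  constructor
  · intro h a b c ha hb hc
    have huu : g.val p u u = -1 := hu
    have h := h a b c u
    rw [weylMagnetic, orthProj_of_orthogonal _ _ ha, orthProj_of_orthogonal _ _ hb, ha, hb, hc,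
      huu] at h
    linarith
  · intro h a b c d
    -- By pair symmetry, all four terms of the magnetic part are components of this form.
    have h' (a b c : TangentSpace I p) :
        g.weyl p (g.orthProj p u a) (g.orthProj p u b) u c = 0 := by
      rw [← weyl_orthProj_right]
      exact h _ _ _ (hu.val_orthProj a) (hu.val_orthProj b) (hu.val_orthProj c)
    rw [weylMagnetic, g.weyl_pair_symm p b u, g.weyl_pair_symm p a u,
      g.weyl_antisymm_right p _ _ b u, g.weyl_antisymm_right p _ _ a u]
    simp only [h']
    ring

/-- For `a`, `b` orthogonal to `u`, the scalar curvature and half of the Ricci terms drop out of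
`C_{abuc}`. -/
theorem weyl_of_orthogonal (hn : 2 < Module.finrank ℝ E) {u a b : TangentSpace I p}
    (ha : g.val p u a = 0) (hb : g.val p u b = 0) (c : TangentSpace I p) :
    g.weyl p a b u c = g.riemann p a b u c +
      (g.val p a c * g.ricci p u b - g.val p b c * g.ricci p u a)
        / ((Module.finrank ℝ E : ℝ) - 2) := by
  rw [weyl, if_neg hn.not_ge, g.symm p a u, g.symm p b u, ha, hb, g.ricci_symm p b u,
    g.ricci_symm p a u]
  ring

theorem weyl_eq_riemann_of_ricci_eq_zero (hn : 2 < Module.finrank ℝ E) {u a b : TangentSpace I p}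
    (ha : g.val p u a = 0) (hb : g.val p u b = 0) (ha' : g.ricci p u a = 0)
    (hb' : g.ricci p u b = 0) (c : TangentSpace I p) :
    g.weyl p a b u c = g.riemann p a b u c := by
  rw [weyl_of_orthogonal _ _ hn ha hb, ha', hb']
  simp

/-- In dimension at most two the orthogonal complement of `u` is at most a line, so the
antisymmetry of the first two slots makes `R_{abcd}` vanish on it. -/
theorem riemann_eq_zero_of_finrank_le_two (hn : Module.finrank ℝ E ≤ 2) {u : TangentSpace I p}
    (hu : g.IsUnitTimelike p u) {a b : TangentSpace I p} (ha : g.val p u a = 0)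
    (hb : g.val p u b = 0) (c d : TangentSpace I p) : g.riemann p a b c d = 0 := by
  have huu : g.val p u u = -1 := hu
  have hdep : ¬LinearIndependent ℝ ![u, a, b] := fun h ↦ by
    have h3 : Fintype.card (Fin 3) ≤ Module.finrank ℝ E := h.fintype_card_le_finrank
    simp at h3
    omega
  -- The coefficient of `u` in the dependency vanishes, because `a` and `b` are orthogonal to `u`.
  obtain ⟨r, hr, i, hi⟩ := Fintype.not_linearIndependent_iff.1 hdep
  simp only [Fin.sum_univ_three, Matrix.cons_val] at hr
  have hr0 : r 0 = 0 := by
    have h := congr(g.val p u $hr)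
    simpa [huu, ha, hb] using h
  rw [hr0, zero_smul, zero_add] at hr
  have haa := g.riemann_antisymm_left p a a c d
  have hbb := g.riemann_antisymm_left p b b c d
  have hab := g.riemann_antisymm_left p a b c d
  have h₁ := g.riemann_add_smul_left p a b b c d (r 1) (r 2)
  have h₂ := g.riemann_add_smul_left p a b a c d (r 1) (r 2)
  rw [hr, riemann_zero_left] at h₁ h₂
  have h₁' : r 1 * g.riemann p a b c d = 0 := by
    rw [show g.riemann p b b c d = 0 by linarith] at h₁
    linarith
  have h₂' : r 2 * g.riemann p a b c d = 0 := by
    rw [show g.riemann p a a c d = 0 by linarith] at h₂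
    rw [hab]
    linarith
  fin_cases i
  · exact absurd hr0 hi
  · exact (mul_eq_zero.1 h₁').resolve_left hi
  · exact (mul_eq_zero.1 h₂').resolve_left hi

end Pointwise

end PseudoRiemannianMetric

/-! ### Purely electric direct products -/

theorem liftFst_eq {E₁ H₁ : Type*} [NormedAddCommGroup E₁] [NormedSpace ℝ E₁]
    [TopologicalSpace H₁] {I₁ : ModelWithCorners ℝ E₁ H₁}
    {M₁ : Type*} [TopologicalSpace M₁] [ChartedSpace H₁ M₁]
    {E₂ H₂ : Type*} [NormedAddCommGroup E₂] [NormedSpace ℝ E₂]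
    [TopologicalSpace H₂] {I₂ : ModelWithCorners ℝ E₂ H₂}
    {M₂ : Type*} [TopologicalSpace M₂] [ChartedSpace H₂ M₂] {p : M₁ × M₂}
    (u : TangentSpace I₁ p.1) :
    liftFst I₁ I₂ p u = ((u, 0) : TangentSpace I₁ p.1 × TangentSpace I₂ p.2) :=
  congr($(mfderiv_prod_left (I := I₁) (I' := I₂) (x₀ := p.1) (y₀ := p.2)) u)

namespace PseudoRiemannianMetric

section ProductPointwise

variable {E₁ H₁ : Type*} [NormedAddCommGroup E₁] [NormedSpace ℝ E₁]
  [TopologicalSpace H₁] {I₁ : ModelWithCorners ℝ E₁ H₁}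
  {M₁ : Type*} [TopologicalSpace M₁] [ChartedSpace H₁ M₁] [IsManifold I₁ ∞ M₁]
  {E₂ H₂ : Type*} [NormedAddCommGroup E₂] [NormedSpace ℝ E₂]
  [TopologicalSpace H₂] {I₂ : ModelWithCorners ℝ E₂ H₂}
  {M₂ : Type*} [TopologicalSpace M₂] [ChartedSpace H₂ M₂] [IsManifold I₂ ∞ M₂]
  (g₁ : PseudoRiemannianMetric I₁ M₁) (g₂ : PseudoRiemannianMetric I₂ M₂) {p : M₁ × M₂}

theorem prod_val_liftFst (u : TangentSpace I₁ p.1) (w : TangentSpace (I₁.prod I₂) p) :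
    (g₁.prod g₂).val p (liftFst I₁ I₂ p u) w = g₁.val p.1 u w.1 := by
  rw [prod_val_apply, liftFst_eq]
  exact (congr(_ + $(congr($(map_zero (g₂.val p.2)) w.2)))).trans (add_zero _)

theorem IsUnitTimelike.liftFst {u : TangentSpace I₁ p.1} (hu : g₁.IsUnitTimelike p.1 u) :
    (g₁.prod g₂).IsUnitTimelike p (liftFst I₁ I₂ p u) := by
  rw [IsUnitTimelike, prod_val_liftFst, liftFst_eq]
  exact hu

variable [I₁.Boundaryless] [I₂.Boundaryless] [FiniteDimensional ℝ E₁] [FiniteDimensional ℝ E₂]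

theorem ricci_prod_liftFst (u : TangentSpace I₁ p.1) (w : TangentSpace (I₁.prod I₂) p) :
    (g₁.prod g₂).ricci p (liftFst I₁ I₂ p u) w = g₁.ricci p.1 u w.1 := by
  rw [ricci_prod, liftFst_eq]
  exact (congr(_ + $(congr($(map_zero (g₂.ricci p.2)) w.2)))).trans (add_zero _)

theorem riemann_prod_liftFst (u : TangentSpace I₁ p.1) (a b c : TangentSpace (I₁.prod I₂) p) :
    (g₁.prod g₂).riemann p a b (liftFst I₁ I₂ p u) c = g₁.riemann p.1 a.1 b.1 u c.1 := by
  rw [riemann_prod, liftFst_eq]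
  exact congr(_ + $(g₂.riemann_zero_third p.2 a.2 b.2 c.2)).trans (add_zero _)

theorem isRicciEigenvector_prod_iff {u : TangentSpace I₁ p.1} (hu : g₁.IsUnitTimelike p.1 u) :
    (g₁.prod g₂).IsRicciEigenvector p (liftFst I₁ I₂ p u) ↔ g₁.IsRicciEigenvector p.1 u := by
  rw [isRicciEigenvector_iff _ _ (hu.liftFst g₁ g₂), isRicciEigenvector_iff _ _ hu]
  simp only [prod_val_liftFst, ricci_prod_liftFst]
  exact ⟨fun h w hw ↦ h ((w, 0) : TangentSpace I₁ p.1 × TangentSpace I₂ p.2) hw,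
    fun h w hw ↦ h w.1 hw⟩

theorem weyl_prod_liftFst (hn : 2 < Module.finrank ℝ (E₁ × E₂)) {u : TangentSpace I₁ p.1}
    {a b : TangentSpace (I₁.prod I₂) p} (ha : g₁.val p.1 u a.1 = 0) (hb : g₁.val p.1 u b.1 = 0)
    (c : TangentSpace (I₁.prod I₂) p) :
    (g₁.prod g₂).weyl p a b (liftFst I₁ I₂ p u) c = g₁.riemann p.1 a.1 b.1 u c.1 +
      ((g₁.prod g₂).val p a c * g₁.ricci p.1 u b.1 - (g₁.prod g₂).val p b c * g₁.ricci p.1 u a.1)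
        / ((Module.finrank ℝ (E₁ × E₂) : ℝ) - 2) := by
  rw [weyl_of_orthogonal _ _ hn ((prod_val_liftFst g₁ g₂ u a).trans ha)
    ((prod_val_liftFst g₁ g₂ u b).trans hb), riemann_prod_liftFst, ricci_prod_liftFst,
    ricci_prod_liftFst]

/-- If the product is purely electric, then `u` is an eigenvector of the Ricci tensor of the first
factor. For `e` tangent to the second factor and `w` tangent to the first and orthogonal to `u`,
the Riemann tensor of the product does not contribute to `C(e, w, u, e) = 0`, which leaves
`g(e, e) Ric(u, w) = 0`; here `g(e, e) > 0`. -/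
theorem IsPurelyElectricAt.isRicciEigenvector_fst [Nontrivial E₂] (hg₂ : g₂.IsRiemannian)
    {u : TangentSpace I₁ p.1} (hu : g₁.IsUnitTimelike p.1 u)
    (h : (g₁.prod g₂).IsPurelyElectricAt p (liftFst I₁ I₂ p u)) :
    g₁.IsRicciEigenvector p.1 u := by
  rw [isRicciEigenvector_iff _ _ hu]
  intro w hw
  have hE₂ : 0 < Module.finrank ℝ E₂ := Module.finrank_pos
  rcases le_or_gt (Module.finrank ℝ E₁) 1 with hn₁ | hn₁
  · rw [g₁.eq_zero_of_orthogonal_of_finrank_le_one p.1 hn₁ hu hw, map_zero]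
  have hn : 2 < Module.finrank ℝ (E₁ × E₂) := by
    rw [Module.finrank_prod]
    omega
  obtain ⟨e, he⟩ : ∃ e : TangentSpace I₂ p.2, e ≠ 0 := exists_ne (0 : E₂)
  let a : TangentSpace (I₁.prod I₂) p := ((0, e) : TangentSpace I₁ p.1 × TangentSpace I₂ p.2)
  let b : TangentSpace (I₁.prod I₂) p := ((w, 0) : TangentSpace I₁ p.1 × TangentSpace I₂ p.2)
  have ha₁ : a.1 = (0 : TangentSpace I₁ p.1) := rfl
  have ha₂ : a.2 = e := rfl
  have hb₁ : b.1 = w := rfl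
  have hb₂ : b.2 = (0 : TangentSpace I₂ p.2) := rfl
  have ha : g₁.val p.1 u a.1 = 0 := by rw [ha₁, map_zero]
  have hC := (isPurelyElectricAt_iff _ _ (hu.liftFst g₁ g₂)).1 h a b a
    ((prod_val_liftFst g₁ g₂ u a).trans ha) ((prod_val_liftFst g₁ g₂ u b).trans hw)
    ((prod_val_liftFst g₁ g₂ u a).trans ha)
  have hR : g₁.riemann p.1 a.1 b.1 u a.1 = 0 := g₁.riemann_zero_left p.1 _ _ _
  have hric : g₁.ricci p.1 u a.1 = 0 := by rw [ha₁, map_zero]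
  have haa : (g₁.prod g₂).val p a a = g₂.val p.2 e e := by
    rw [prod_val_apply, ha₁, ha₂, map_zero, zero_add]
  rw [weyl_prod_liftFst _ _ hn ha hw, hR, hric, haa, mul_zero, sub_zero, zero_add,
    div_eq_zero_iff] at hC
  have hn' : (2 : ℝ) < Module.finrank ℝ (E₁ × E₂) := by exact_mod_cast hn
  exact (mul_eq_zero.1 (hC.resolve_right (by linarith))).resolve_left (hg₂ p.2 e he).ne'

/-- Once the mixed Ricci components vanish, `C_{abuc}` is `R_{abuc}` both in the product and in the
first factor, and `R_{abuc}` depends only on the first components of `a`, `b`, `c`. The dimensions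
in which a Weyl tensor is zero by convention are treated separately. -/
theorem isPurelyElectricAt_prod_iff [Nontrivial E₂] (hg₂ : g₂.IsRiemannian)
    {u : TangentSpace I₁ p.1} (hu : g₁.IsUnitTimelike p.1 u) :
    (g₁.prod g₂).IsPurelyElectricAt p (liftFst I₁ I₂ p u) ↔
      g₁.IsRicciEigenvector p.1 u ∧ g₁.IsPurelyElectricAt p.1 u := by
  constructor
  · intro h
    have hev := h.isRicciEigenvector_fst g₁ g₂ hg₂ hu
    refine ⟨hev, ?_⟩
    rcases le_or_gt (Module.finrank ℝ E₁) 2 with hn₁ | hn₁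
    · exact g₁.isPurelyElectricAt_of_finrank_le_two p.1 hn₁ u
    have hn : 2 < Module.finrank ℝ (E₁ × E₂) := by
      rw [Module.finrank_prod]
      omega
    rw [isRicciEigenvector_iff _ _ hu] at hev
    rw [isPurelyElectricAt_iff _ _ (hu.liftFst g₁ g₂)] at h
    rw [isPurelyElectricAt_iff _ _ hu]
    intro a b c ha hb hc
    let lift (v : TangentSpace I₁ p.1) : TangentSpace (I₁.prod I₂) p :=
      ((v, 0) : TangentSpace I₁ p.1 × TangentSpace I₂ p.2)
    have hlift (v : TangentSpace I₁ p.1) : (lift v).1 = v := rfl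
    have hC := h (lift a) (lift b) (lift c) ((prod_val_liftFst g₁ g₂ u (lift a)).trans ha)
      ((prod_val_liftFst g₁ g₂ u (lift b)).trans hb) ((prod_val_liftFst g₁ g₂ u (lift c)).trans hc)
    rw [weyl_prod_liftFst _ _ hn ha hb, hlift, hlift, hlift, hev a ha, hev b hb] at hC
    rw [weyl_eq_riemann_of_ricci_eq_zero _ _ hn₁ ha hb (hev a ha) (hev b hb)]
    simpa using hC
  · rintro ⟨hev, h⟩
    rcases le_or_gt (Module.finrank ℝ (E₁ × E₂)) 2 with hn | hn
    · exact (g₁.prod g₂).isPurelyElectricAt_of_finrank_le_two p hn _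
    rw [isRicciEigenvector_iff _ _ hu] at hev
    rw [isPurelyElectricAt_iff _ _ hu] at h
    rw [isPurelyElectricAt_iff _ _ (hu.liftFst g₁ g₂)]
    intro a b c ha hb hc
    rw [prod_val_liftFst] at ha hb hc
    have hR : g₁.riemann p.1 a.1 b.1 u c.1 = 0 := by
      rcases le_or_gt (Module.finrank ℝ E₁) 2 with hn₁ | hn₁
      · exact g₁.riemann_eq_zero_of_finrank_le_two p.1 hn₁ hu ha hb u c.1
      · exact (g₁.weyl_eq_riemann_of_ricci_eq_zero p.1 hn₁ ha hb (hev _ ha) (hev _ hb) c.1).symm.trans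
          (h a.1 b.1 c.1 ha hb hc)
    rw [weyl_prod_liftFst _ _ hn ha hb, hR, hev _ ha, hev _ hb]
    simp

end ProductPointwise

end PseudoRiemannianMetric

end Lorentz

theorem proposition9
    {E₁ H₁ : Type*} [NormedAddCommGroup E₁] [NormedSpace ℝ E₁] [FiniteDimensional ℝ E₁]
    [TopologicalSpace H₁] (I₁ : ModelWithCorners ℝ E₁ H₁) [I₁.Boundaryless]
    {M₁ : Type*} [TopologicalSpace M₁] [ChartedSpace H₁ M₁] [IsManifold I₁ ∞ M₁]
    {E₂ H₂ : Type*} [NormedAddCommGroup E₂] [NormedSpace ℝ E₂] [FiniteDimensional ℝ E₂]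
    [Nontrivial E₂]
    [TopologicalSpace H₂] (I₂ : ModelWithCorners ℝ E₂ H₂) [I₂.Boundaryless]
    {M₂ : Type*} [TopologicalSpace M₂] [ChartedSpace H₂ M₂] [IsManifold I₂ ∞ M₂]
    (g₁ : Lorentz.PseudoRiemannianMetric I₁ M₁) (g₂ : Lorentz.PseudoRiemannianMetric I₂ M₂)
    (hg₁ : g₁.IsLorentzian) (hg₂ : g₂.IsRiemannian)
    (S : Set (M₁ × M₂)) (u : ∀ p : M₁ × M₂, TangentSpace I₁ p.1)
    (hu : ∀ p ∈ S, g₁.IsUnitTimelike p.1 (u p)) :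
    ((∀ p ∈ S, (g₁.prod g₂).IsPurelyElectricAt p (Lorentz.liftFst I₁ I₂ p (u p))) ↔
      ((∀ p ∈ S, g₁.IsRicciEigenvector p.1 (u p)) ∧
        ∀ p ∈ S, g₁.IsPurelyElectricAt p.1 (u p))) ∧
    ((∀ p ∈ S, (g₁.prod g₂).IsPurelyElectricAt p (Lorentz.liftFst I₁ I₂ p (u p))) →
      ∀ p ∈ S, (g₁.prod g₂).IsRicciEigenvector p (Lorentz.liftFst I₁ I₂ p (u p)) ∧
        ∀ w : TangentSpace (I₁.prod I₂) p,
          (g₁.prod g₂).val p (Lorentz.liftFst I₁ I₂ p (u p)) w = 0 →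
            (g₁.prod g₂).ricci p (Lorentz.liftFst I₁ I₂ p (u p)) w = 0) := by
  have key := fun p hp ↦ g₁.isPurelyElectricAt_prod_iff g₂ hg₂ (hu p hp)
  refine ⟨?_, fun h p hp ↦ ?_⟩
  · rw [← forall₂_and]
    exact forall₂_congr key
  · have hev := ((key p hp).1 (h p hp)).1
    refine ⟨(g₁.isRicciEigenvector_prod_iff g₂ (hu p hp)).2 hev, fun w hw ↦ ?_⟩
    rw [Lorentz.PseudoRiemannianMetric.prod_val_liftFst] at hw
    rw [Lorentz.PseudoRiemannianMetric.ricci_prod_liftFst]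
    exact (g₁.isRicciEigenvector_iff p.1 (hu p hp)).1 hev w.1 hw
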